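/- Let $n\in\mathbb N$ and consider a block of $n$ qubits with Hilbert space $(\mathbb C^2)^{\otimes n}$. For $0\le k\le n-1$ let $|e_k\rangle$ be the computational basis state whose only excitation sits at site $k$, let $\mathcal H_1=\mathrm{span}\{|e_0\rangle,\dots,|e_{n-1}\rangle\}\cong\mathbb C^n$ be the one-excitation sector, and let $X_i,Y_i$ be the Pauli operators acting on qubit $i$. Let $$\mathcal G=\{\,X_iX_j+Y_iY_j : 0\le i<j\le n-1\,\}\cup\{H_Z\},$$ where $H_Z$ is any Hermitian operator on $(\mathbb C^2)^{\otimes n}$ that is diagonal in the computational basis (hence excitation-preserving) and whose restriction to $\mathcal H_1$ is not proportional to the identity. Every $H\in\mathcal G$ maps $\mathcal H_1$ to itself. Let $\mathfrak L$ be the real Lie algebra generated by the restrictions $iH|_{\mathcal H_1}$, $H\in\mathcal G$ (the dynamical Lie algebra on $\mathcal H_1$). Then: 1. Up to global phases, $\mathfrak L$ is $\mathfrak{su}(n)$: the image of $\mathfrak L$ under $X\mapsto X-\frac{\operatorname{tr}X}{n}I$ is $\mathfrak{su}(n)$. More precisely, $\mathfrak L=\mathfrak{su}(n)$ if $\operatorname{tr}(H_Z|_{\mathcal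 H_1})=0$, and $\mathfrak L=\mathfrak u(n)=\mathfrak{su}(n)\oplus i\mathbb R I$ if $\operatorname{tr}(H_Z|_{\mathcal H_1})\neq 0$. 2. Consequently, for every $V\in \mathrm{SU}(n)$ and every $\varepsilon>0$ there are $L\in\mathbb N$, angles $\theta_1,\dots,\theta_L\in\mathbb R$ and $H_1,\dots,H_L\in\mathcal G$ such that, in operator norm on $\mathcal H_1\cong\mathbb C^n$, $$\Bigl\|\,V-\Bigl(\prod_{\ell=1}^{L}e^{-i\theta_\ell H_\ell}\Bigr)\Big|_{\mathcal H_1}\Bigr\|\le\varepsilon .$$ -/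

import Mathlib

attribute [local instance 100] LieRing.ofAssociativeRing

namespace OneHotBlock

open Matrix

/-- Computational basis labels of an `n`-qubit block: bit strings of length `n`. -/
abbrev BitString (n : ℕ) : Type := Fin n → Fin 2

/-- Operators on the Hilbert space `(ℂ²)^{⊗ n}` of an `n`-qubit block, as matrices in the
computational basis. -/
abbrev BlockOperator (n : ℕ) : Type := Matrix (BitString n) (BitString n) ℂ

/-- The Pauli matrix `X`. -/
def pauliX : Matrix (Fin 2) (Fin 2) ℂ := !![0, 1; 1, 0]

/-- The Pauli matrix `Y`. -/
def pauliY : Matrix (Fin 2) (Fin 2) ℂ := !![0, -Complex.I; Complex.I, 0]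

/-- The one-qubit operator `A` acting on the `k`-th tensor factor:
`1 ⊗ ⋯ ⊗ A ⊗ ⋯ ⊗ 1`. -/
def onQubit {n : ℕ} (k : Fin n) (A : Matrix (Fin 2) (Fin 2) ℂ) : BlockOperator n :=
  Matrix.of fun x y => if ∀ l, l ≠ k → x l = y l then A (x k) (y k) else 0

/-- The XY hopping term `X_i X_j + Y_i Y_j`. -/
def hopping {n : ℕ} (i j : Fin n) : BlockOperator n :=
  onQubit i pauliX * onQubit j pauliX + onQubit i pauliY * onQubit j pauliY

/-- The operator set `{X_i X_j + Y_i Y_j : i < j} ∪ {HZ}`. -/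
def controlSet {n : ℕ} (HZ : BlockOperator n) : Set (BlockOperator n) :=
  {H | ∃ i j : Fin n, i < j ∧ H = hopping i j} ∪ {HZ}

/-- The one-hot bit string `e_k`, whose single excitation sits at site `k`. -/
def oneHot {n : ℕ} (k : Fin n) : BitString n := Pi.single k 1

/-- The isometry `ℂⁿ → (ℂ²)^{⊗ n}`, `|k⟩ ↦ |e_k⟩`, whose range is the one-excitation sector
`span {|e_0⟩, …, |e_{n-1}⟩}`. -/
def encoding (n : ℕ) : Matrix (BitString n) (Fin n) ℂ :=
  Matrix.of fun x k => if x = oneHot k then 1 else 0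

/-- The restriction of an operator to the one-excitation sector, as a matrix in the basis
`|e_0⟩, …, |e_{n-1}⟩`. It is the matrix of the restricted operator as soon as the operator
preserves the sector; see `controlSet_preserves_sector`. -/
def restrictSector {n : ℕ} (H : BlockOperator n) : Matrix (Fin n) (Fin n) ℂ :=
  (encoding n)ᴴ * H * encoding n

lemma restrictSector_apply {n : ℕ} (H : BlockOperator n) (k l : Fin n) :
    restrictSector H k l = H (oneHot k) (oneHot l) := by
  simp [restrictSector, encoding, Matrix.mul_apply, Matrix.conjTranspose_apply, apply_ite]

lemma oneHot_injective {n : ℕ} : Function.Injective (oneHot : Fin n → BitString n) := by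
  intro k l h
  by_contra hkl
  have := congrFun h k
  simp [oneHot, hkl] at this

lemma onQubit_mul_onQubit_apply {n : ℕ} {i j : Fin n} (hij : i ≠ j)
    (A B : Matrix (Fin 2) (Fin 2) ℂ) (x y : BitString n) :
    (onQubit i A * onQubit j B) x y
      = if ∀ l, l ≠ i → l ≠ j → x l = y l then A (x i) (y i) * B (x j) (y j) else 0 := by
  rw [Matrix.mul_apply, Finset.sum_eq_single (Function.update x i (y i))]
  · have h1 : ∀ l, l ≠ i → x l = Function.update x i (y i) l := fun l hl => by simp [hl]
    have h2 : (∀ l, l ≠ j → Function.update x i (y i) l = y l)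
        ↔ ∀ l, l ≠ i → l ≠ j → x l = y l := by
      refine forall_congr' fun l => ?_
      by_cases hl : l = i
      · subst hl; simp
      · simp [hl]
    simp only [onQubit, Matrix.of_apply, if_pos h1, h2]
    simp [hij.symm]
  · intro z _ hz
    simp only [onQubit, Matrix.of_apply]
    split_ifs with h1 h2
    · refine absurd (funext fun l => ?_) hz
      by_cases hl : l = i
      · subst hl; simpa using h2 l hij
      · simpa [hl] using (h1 l hl).symm
    all_goals simp
  · simp

/-- `X_i X_j + Y_i Y_j` maps `|e_i⟩` to `2 |e_j⟩`, maps `|e_j⟩` to `2 |e_i⟩`, and kills the other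
one-hot states. -/
lemma hopping_apply_oneHot {n : ℕ} {i j : Fin n} (hij : i < j) (x : BitString n) (k : Fin n) :
    hopping i j x (oneHot k)
      = if (k = i ∧ x = oneHot j) ∨ (k = j ∧ x = oneHot i) then 2 else 0 := by
  have hne : i ≠ j := hij.ne
  have key : ∀ z : BitString n,
      x = z ↔ (∀ l, l ≠ i → l ≠ j → x l = z l) ∧ x i = z i ∧ x j = z j := by
    intro z
    constructor
    · rintro rfl; simp
    · rintro ⟨h, hi, hj⟩
      funext l
      by_cases h1 : l = i
      · rw [h1, hi]
      by_cases h2 : l = j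
      · rw [h2, hj]
      exact h l h1 h2
  have off : ∀ p : Fin n, (p = i ∨ p = j) → ∀ l, l ≠ i → l ≠ j → (oneHot p : BitString n) l = 0 := by
    rintro p (rfl | rfl) l h1 h2 <;> simp [oneHot, h1, h2]
  have bit : ∀ a : Fin 2, a = 0 ∨ a = 1 := by decide
  simp only [hopping, Matrix.add_apply, onQubit_mul_onQubit_apply hne]
  simp only [key (oneHot j), key (oneHot i)]
  by_cases hki : k = i
  · subst hki
    have e1 : (∀ l, l ≠ k → l ≠ j → x l = (oneHot k : BitString n) l) ↔
        (∀ l, l ≠ k → l ≠ j → x l = (oneHot j : BitString n) l) := by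
      refine forall_congr' fun l => forall_congr' fun h1 => forall_congr' fun h2 => ?_
      rw [off k (Or.inl rfl) l h1 h2, off j (Or.inr rfl) l h1 h2]
    simp only [e1]
    rcases bit (x k) with ha | ha <;> rcases bit (x j) with hb | hb <;>
      simp [ha, hb, hne, hne.symm, oneHot, pauliX, pauliY]
    split_ifs <;> norm_num
  by_cases hkj : k = j
  · subst hkj
    have e1 : (∀ l, l ≠ i → l ≠ k → x l = (oneHot k : BitString n) l) ↔
        (∀ l, l ≠ i → l ≠ k → x l = (oneHot i : BitString n) l) := by
      refine forall_congr' fun l => forall_congr' fun h1 => forall_congr' fun h2 => ?_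
      rw [off k (Or.inr rfl) l h1 h2, off i (Or.inl rfl) l h1 h2]
    simp only [e1]
    rcases bit (x i) with ha | ha <;> rcases bit (x k) with hb | hb <;>
      simp [ha, hb, hne, hne.symm, oneHot, pauliX, pauliY]
    split_ifs <;> norm_num
  · have hi : (oneHot k : BitString n) i = 0 := by simp [oneHot, Ne.symm hki]
    have hj : (oneHot k : BitString n) j = 0 := by simp [oneHot, Ne.symm hkj]
    rw [hi, hj]
    rcases bit (x i) with ha | ha <;> rcases bit (x j) with hb | hb <;>
      simp [ha, hb, hki, hkj, pauliX, pauliY]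
    split_ifs <;> simp

/-- On the one-excitation sector, `X_i X_j + Y_i Y_j` acts as `2 (E_{ij} + E_{ji})`. -/
lemma restrictSector_hopping {n : ℕ} {i j : Fin n} (hij : i < j) :
    restrictSector (hopping i j) = (2 : ℂ) • (Matrix.single i j 1 + Matrix.single j i 1) := by
  ext k l
  rw [restrictSector_apply, hopping_apply_oneHot hij]
  simp only [oneHot_injective.eq_iff, Matrix.smul_apply, Matrix.add_apply, Matrix.single_apply,
    smul_eq_mul]
  have := hij.ne
  grind

/-- Every operator of the control set maps the one-excitation sector to itself, and
`restrictSector` is the matrix of the restricted operator. -/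
lemma controlSet_preserves_sector {n : ℕ} {HZ : BlockOperator n} (hZ : HZ.IsDiag)
    {H : BlockOperator n} (hH : H ∈ controlSet HZ) :
    H * encoding n = encoding n * restrictSector H := by
  have col : ∀ x k, (H * encoding n) x k = H x (oneHot k) := by
    intro x k; simp [Matrix.mul_apply, encoding]
  ext x k
  rw [col, Matrix.mul_apply]
  simp only [restrictSector_apply, encoding, Matrix.of_apply, ite_mul, one_mul, zero_mul]
  by_cases hx : ∃ p, x = oneHot p
  · obtain ⟨p, rfl⟩ := hx
    simp [oneHot_injective.eq_iff]
  · push Not at hx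
    simp only [hx, if_false, Finset.sum_const_zero]
    rcases hH with ⟨i, j, hij, rfl⟩ | rfl
    · simp [hopping_apply_oneHot hij, hx]
    · exact hZ (hx k)

/-- The real Lie algebra `𝔲(n)` of skew-Hermitian matrices. -/
def unitaryLieAlgebra (n : ℕ) : LieSubalgebra ℝ (Matrix (Fin n) (Fin n) ℂ) where
  carrier := {X | Xᴴ = -X}
  add_mem' := by
    intro X Y hX hY
    simp only [Set.mem_ofPred_eq] at *
    rw [Matrix.conjTranspose_add, hX, hY, neg_add]
  zero_mem' := by simp
  smul_mem' := by
    intro c X hX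
    simp only [Set.mem_ofPred_eq] at *
    rw [Matrix.conjTranspose_smul, hX, star_trivial, smul_neg]
  lie_mem' := by
    intro X Y hX hY
    change Xᴴ = -X at hX
    change Yᴴ = -Y at hY
    change (⁅X, Y⁆)ᴴ = -⁅X, Y⁆
    rw [Ring.lie_def, Matrix.conjTranspose_sub, Matrix.conjTranspose_mul,
      Matrix.conjTranspose_mul, hX, hY]
    noncomm_ring

/-- The real Lie algebra `𝔰𝔲(n)` of traceless skew-Hermitian matrices. -/
def specialUnitaryLieAlgebra (n : ℕ) : LieSubalgebra ℝ (Matrix (Fin n) (Fin n) ℂ) where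
  carrier := {X | Xᴴ = -X ∧ X.trace = 0}
  add_mem' := by
    rintro X Y ⟨hX, hX'⟩ ⟨hY, hY'⟩
    exact ⟨(unitaryLieAlgebra n).add_mem hX hY, by rw [Matrix.trace_add, hX', hY', add_zero]⟩
  zero_mem' := by simp
  smul_mem' := by
    rintro c X ⟨hX, hX'⟩
    exact ⟨(unitaryLieAlgebra n).smul_mem c hX, by rw [Matrix.trace_smul, hX', smul_zero]⟩
  lie_mem' := by
    rintro X Y ⟨hX, _⟩ ⟨hY, _⟩
    exact ⟨(unitaryLieAlgebra n).lie_mem hX hY, by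
      rw [Ring.lie_def, Matrix.trace_sub, Matrix.trace_mul_comm, sub_self]⟩

/-- The dynamical Lie algebra on the one-excitation sector: the real Lie algebra generated by the
matrices `i H`, where `H` runs through the restrictions of the operators of `G`. -/
noncomputable def dynamicalLieAlgebra {n : ℕ} (G : Set (BlockOperator n)) :
    LieSubalgebra ℝ (Matrix (Fin n) (Fin n) ℂ) :=
  LieSubalgebra.lieSpan ℝ (Matrix (Fin n) (Fin n) ℂ)
    ((fun H => Complex.I • restrictSector H) '' G)

/-- The traceless part `X - (tr X / n) 1` of a matrix: removing the component along the identity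
that generates a global phase. -/
noncomputable def tracelessPart {n : ℕ} (X : Matrix (Fin n) (Fin n) ℂ) : Matrix (Fin n) (Fin n) ℂ :=
  X - (X.trace / (n : ℂ)) • (1 : Matrix (Fin n) (Fin n) ℂ)

end OneHotBlock

open scoped Matrix.Norms.L2Operator

/-!
Restricted to the one-excitation sector, the hopping term along `i, j` is `2 (E_ij + E_ji)`, and the
diagonal term is a real diagonal matrix `diag d` which is not scalar. Write
`S_ij = i (E_ij + E_ji)` and `A_ij = E_ij - E_ji`.

**The Lie algebra.** The bracket of `i diag d` with `S_ij` is a nonzero multiple of `A_ij` when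
`d i ≠ d j`; when `d i = d j`, some `k` has `d k ≠ d i`, so `k` is a third site and `A_ij` is, up to
sign, the bracket of `S_ik` and `S_kj` (`antisymm_mem`). Brackets of `A_ij` with `S_ij` give
`i (E_ii - E_jj)`, and all these matrices span `𝔰𝔲(n)` (`specialUnitary_le`). The generators are
skew-Hermitian, and the hopping terms are traceless, so the generated algebra lies in `𝔲(n)`, and in
`𝔰𝔲(n)` if the diagonal term is traceless; otherwise the diagonal term supplies the global phases
(`unitary_le_of_specialUnitary_le`).

**Universality.** The elements `x` of a Banach algebra whose one-parameter group `exp (t x)` lies in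
a given closed submonoid form a Lie algebra (`closedSubmonoidLieAlgebra`); closure under sums is the
Lie product formula (`tendsto_exp_mul_exp_pow`). Applied to the closure of the restricted circuits,
whose Lie algebra contains the generators and hence `𝔰𝔲(n)`, this shows that every `exp X` with
`X ∈ 𝔰𝔲(n)` is a limit of circuits. Every element of `SU(n)` is of this form
(`exists_traceless_exp_eq`). Finally, since the sector is invariant, the restriction of a circuit on
the block is the product of the exponentials of the restrictions (`restrictSector_circuit`).
-/

namespace OneHotBlock

/-! ### The Lie algebra of a closed multiplicative submonoid -/

section ClosedSubmonoid

open Filter Topology NormedSpace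

variable {A : Type*} [NormedRing A]

lemma norm_pow_mul_le {a : A} {r : ℝ} (hr : 0 ≤ r) (ha : ‖a‖ ≤ r) (c : A) (n : ℕ) :
    ‖a ^ n * c‖ ≤ r ^ n * ‖c‖ := by
  induction n with
  | zero => simp
  | succ n ih =>
    calc ‖a ^ (n + 1) * c‖ = ‖a * (a ^ n * c)‖ := by rw [pow_succ', mul_assoc]
      _ ≤ ‖a‖ * ‖a ^ n * c‖ := norm_mul_le _ _
      _ ≤ r * (r ^ n * ‖c‖) := by gcongr
      _ = r ^ (n + 1) * ‖c‖ := by ring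

lemma norm_pow_sub_pow_le {a b : A} {r : ℝ} (hr : 1 ≤ r) (ha : ‖a‖ ≤ r) (hb : ‖b‖ ≤ r) (n : ℕ) :
    ‖a ^ n - b ^ n‖ ≤ n * r ^ n * ‖a - b‖ := by
  have hr0 : 0 ≤ r := zero_le_one.trans hr
  induction n with
  | zero => simp
  | succ n ih =>
    have h1 : ‖(a ^ n - b ^ n) * b‖ ≤ r * (n * r ^ n * ‖a - b‖) := by
      rw [mul_comm r]
      exact (norm_mul_le _ _).trans (by gcongr)
    have h2 : ‖a ^ n * (a - b)‖ ≤ r ^ n * ‖a - b‖ := norm_pow_mul_le hr0 ha _ n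
    have h3 : r ^ n * ‖a - b‖ ≤ r ^ (n + 1) * ‖a - b‖ := by
      gcongr
      · exact n.le_succ
    calc ‖a ^ (n + 1) - b ^ (n + 1)‖ = ‖(a ^ n - b ^ n) * b + a ^ n * (a - b)‖ := by
          congr 1; rw [pow_succ, pow_succ]; noncomm_ring
      _ ≤ r * (n * r ^ n * ‖a - b‖) + r ^ (n + 1) * ‖a - b‖ :=
          (norm_add_le _ _).trans (add_le_add h1 (h2.trans h3))
      _ = ((n + 1 : ℕ) : ℝ) * r ^ (n + 1) * ‖a - b‖ := by push_cast; ring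

variable [NormedAlgebra ℝ A] [CompleteSpace A]

lemma norm_exp_le_exp_norm [NormOneClass A] (x : A) : ‖exp x‖ ≤ Real.exp ‖x‖ := by
  rw [Real.exp_eq_exp_ℝ]
  have h := exp_series_hasSum_exp' (𝕂 := ℝ) x
  rw [← h.tsum_eq]
  refine tsum_of_norm_bounded (exp_series_hasSum_exp' (𝕂 := ℝ) ‖x‖) fun k => ?_
  rw [norm_smul, smul_eq_mul]
  have h1 : ‖((k.factorial : ℝ)⁻¹)‖ = (k.factorial : ℝ)⁻¹ := by
    rw [Real.norm_eq_abs, abs_of_nonneg (by positivity)]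
  rw [h1]
  gcongr
  exact norm_pow_le x k

/-- The Lie product formula. The two curves `s ↦ exp (s x) * exp (s y)` and `s ↦ exp (s (x + y))`
agree to first order at `0`, and taking `k`-th powers multiplies a discrepancy `o(1 / k)` by at
most a constant times `k`. -/
lemma tendsto_exp_mul_exp_pow [NormOneClass A] (x y : A) :
    Tendsto (fun k : ℕ => (exp ((k : ℝ)⁻¹ • x) * exp ((k : ℝ)⁻¹ • y)) ^ k) atTop
      (𝓝 (exp (x + y))) := by
  let _ : NormedAlgebra ℚ A := NormedAlgebra.restrictScalars ℚ ℝ A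
  set g : ℝ → A := fun s => exp (s • x) * exp (s • y) - exp (s • (x + y)) with hg
  have hd : HasDerivAt g 0 0 := by
    have h := ((hasDerivAt_exp_smul_const x (0 : ℝ)).mul
      (hasDerivAt_exp_smul_const y (0 : ℝ))).sub (hasDerivAt_exp_smul_const (x + y) (0 : ℝ))
    rw [hg]
    simpa only [zero_smul, exp_zero, one_mul, mul_one, smul_zero, sub_self] using! h
  have hg0 : g 0 = 0 := by simp [hg]
  have hinv : Tendsto (fun k : ℕ => (k : ℝ)⁻¹) atTop (𝓝[≠] 0) := by
    refine tendsto_nhdsWithin_iff.2 ⟨tendsto_inv_atTop_nhds_zero_nat, ?_⟩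
    filter_upwards [eventually_gt_atTop 0] with k hk
    simp [hk.ne']
  have hslope : Tendsto (fun k : ℕ => ((k : ℝ)⁻¹)⁻¹ • g (k : ℝ)⁻¹) atTop (𝓝 0) := by
    simpa [Function.comp_def, hg0] using hd.tendsto_slope_zero.comp hinv
  rw [tendsto_iff_norm_sub_tendsto_zero]
  have hlim := (hslope.norm.const_mul (Real.exp (‖x‖ + ‖y‖)))
  rw [norm_zero, mul_zero] at hlim
  refine squeeze_zero' (Eventually.of_forall fun _ => norm_nonneg _) ?_ hlim
  filter_upwards [eventually_gt_atTop 0] with k hk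
  have hk' : (0 : ℝ) < k := Nat.cast_pos.2 hk
  have hns : ∀ z : A, ‖(k : ℝ)⁻¹ • z‖ = (k : ℝ)⁻¹ * ‖z‖ := fun z => by
    rw [norm_smul, Real.norm_of_nonneg (by positivity)]
  -- Both factors have norm at most `r`, and `r ^ k` does not depend on `k`.
  set r : ℝ := Real.exp ((k : ℝ)⁻¹ * (‖x‖ + ‖y‖)) with hr
  have hr1 : 1 ≤ r := Real.one_le_exp (by positivity)
  have hrk : r ^ k = Real.exp (‖x‖ + ‖y‖) := by
    rw [hr, ← Real.exp_nat_mul, mul_inv_cancel_left₀ hk'.ne']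
  have ha : ‖exp ((k : ℝ)⁻¹ • x) * exp ((k : ℝ)⁻¹ • y)‖ ≤ r := by
    refine (norm_mul_le _ _).trans ?_
    rw [hr, mul_add, Real.exp_add]
    have h1 := norm_exp_le_exp_norm ((k : ℝ)⁻¹ • x)
    have h2 := norm_exp_le_exp_norm ((k : ℝ)⁻¹ • y)
    rw [hns] at h1 h2
    gcongr
  have hb : ‖exp ((k : ℝ)⁻¹ • (x + y))‖ ≤ r := by
    refine (norm_exp_le_exp_norm _).trans ?_
    rw [hns, hr]
    gcongr
    exact norm_add_le _ _
  have hbk : exp (x + y) = exp ((k : ℝ)⁻¹ • (x + y)) ^ k := by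
    rw [← exp_nsmul, ← Nat.cast_smul_eq_nsmul ℝ, smul_smul, mul_inv_cancel₀ hk'.ne', one_smul]
  rw [hbk]
  refine (norm_pow_sub_pow_le hr1 ha hb k).trans_eq ?_
  rw [hrk, norm_smul, inv_inv, Real.norm_of_nonneg hk'.le]
  ring

/-- The Lie algebra of a closed submonoid `M` of a Banach algebra: the elements whose one-parameter
group lies in `M`. Sums are handled by the Lie product formula. For brackets, the subspace is closed
and stable under conjugation by `exp (s x)`, hence contains the derivative at `s = 0` of
`exp (s x) * y * exp (-s x)`. Inverses are not needed, as `exp (-s x)` is again in `M`. -/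
noncomputable def closedSubmonoidLieAlgebra [NormOneClass A] (M : Submonoid A)
    (hM : IsClosed (M : Set A)) : LieSubalgebra ℝ A :=
  let _ : NormedAlgebra ℚ A := NormedAlgebra.restrictScalars ℚ ℝ A
  let S : Submodule ℝ A :=
    { carrier := {x | ∀ t : ℝ, exp (t • x) ∈ M}
      zero_mem' := fun t => by simp [M.one_mem]
      smul_mem' := fun c x hx t => by
        rw [smul_smul]; exact hx _
      add_mem' := fun {x y} hx hy t => by
        rw [smul_add]
        refine hM.mem_of_tendsto (tendsto_exp_mul_exp_pow (t • x) (t • y))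
          (Eventually.of_forall fun k => M.pow_mem (M.mul_mem ?_ ?_) k)
        · rw [smul_smul]; exact hx _
        · rw [smul_smul]; exact hy _ }
  { S with
    lie_mem' := fun {x y} hx hy => by
      have hS : IsClosed (S : Set A) := by
        have : (S : Set A) = ⋂ t : ℝ, (fun x => exp (t • x)) ⁻¹' (M : Set A) := by
          ext x; simp [S]
        rw [this]
        exact isClosed_iInter fun t => hM.preimage (exp_continuous.comp (continuous_const_smul t))
      have hconj : ∀ s : ℝ, exp (s • x) * y * exp (s • -x) ∈ S := fun s t => by
        have hinv : exp (s • -x) * exp (s • x) = 1 := by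
          rw [← exp_add_of_commute ((Commute.refl x).neg_left.smul_left s |>.smul_right s)]
          simp
        have hinv' : exp (s • x) * exp (s • -x) = 1 := by
          rw [← exp_add_of_commute ((Commute.refl x).neg_right.smul_left s |>.smul_right s)]
          simp
        have h := exp_units_conj (⟨exp (s • x), exp (s • -x), hinv', hinv⟩ : Aˣ) (t • y)
        change exp (exp (s • x) * (t • y) * exp (s • -x))
          = exp (s • x) * exp (t • y) * exp (s • -x) at h
        rw [mul_smul_comm, smul_mul_assoc] at h
        rw [h]
        refine M.mul_mem (M.mul_mem (hx s) (hy t)) ?_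
        rw [smul_neg, ← neg_smul]
        exact hx _
      have hd : HasDerivAt (fun s : ℝ => exp (s • x) * y * exp (s • -x)) ⁅x, y⁆ 0 := by
        have h := ((hasDerivAt_exp_smul_const x (0 : ℝ)).mul_const y).mul
          (hasDerivAt_exp_smul_const (-x) (0 : ℝ))
        simpa [Ring.lie_def, sub_eq_add_neg] using! h
      refine hS.mem_of_tendsto hd.tendsto_slope_zero (Eventually.of_forall fun s => ?_)
      exact S.smul_mem _ (S.sub_mem (hconj _) (hconj _)) }

lemma mem_closedSubmonoidLieAlgebra [NormOneClass A] {M : Submonoid A}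
    {hM : IsClosed (M : Set A)} {x : A} :
    x ∈ closedSubmonoidLieAlgebra M hM ↔ ∀ t : ℝ, exp (t • x) ∈ M :=
  Iff.rfl

end ClosedSubmonoid

/-! ### Generation of `𝔰𝔲(n)` -/

section Generation

open Matrix

variable {n : ℕ}

/-- A real Lie algebra of matrices containing all the hopping terms `i (E_ij + E_ji)` and a
non-scalar real diagonal matrix times `i` contains `E_ij - E_ji`. If `d i ≠ d j` this is a bracket
with the diagonal matrix; otherwise `d k` differs from `d i = d j` for some `k`, and it is the
bracket of the hopping terms along `i, k, j`. -/
lemma antisymm_mem {K : LieSubalgebra ℝ (Matrix (Fin n) (Fin n) ℂ)} {d : Fin n → ℝ}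
    (hS : ∀ i j : Fin n, i ≠ j → Complex.I • (single i j 1 + single j i 1) ∈ K)
    (hD : Complex.I • diagonal (fun k => (d k : ℂ)) ∈ K) (hd : ∃ k l, d k ≠ d l)
    {i j : Fin n} (hij : i ≠ j) :
    (single i j 1 - single j i 1 : Matrix (Fin n) (Fin n) ℂ) ∈ K := by
  by_cases h : d i = d j
  · obtain ⟨k, hk⟩ : ∃ k, d k ≠ d i := by
      by_contra! hc
      obtain ⟨k, l, hkl⟩ := hd
      exact hkl ((hc k).trans (hc l).symm)
    have hki : k ≠ i := fun e => hk (by rw [e])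
    have hkj : k ≠ j := fun e => hk (by rw [e, h])
    have := K.neg_mem (K.lie_mem (hS i k hki.symm) (hS k j hkj))
    have e1 : (single i k 1 + single k i 1 : Matrix (Fin n) (Fin n) ℂ)
        * (single k j 1 + single j k 1) = single i j 1 := by
      simp [mul_add, add_mul, hij, hki.symm, hkj]
    have e2 : (single k j 1 + single j k 1 : Matrix (Fin n) (Fin n) ℂ)
        * (single i k 1 + single k i 1) = single j i 1 := by
      simp [mul_add, add_mul, hij.symm, hki, hkj.symm]
    rwa [Ring.lie_def, smul_mul_smul_comm, smul_mul_smul_comm, e1, e2, Complex.I_mul_I, neg_one_smul,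
      neg_one_smul, neg_sub, sub_neg_eq_add, neg_add_eq_sub] at this
  · have := K.smul_mem (-(d i - d j)⁻¹) (K.lie_mem hD (hS i j hij))
    convert this using 1
    have h' : (d i : ℂ) - d j ≠ 0 := by
      rw [← Complex.ofReal_sub]; exact_mod_cast sub_ne_zero.2 h
    ext a b
    simp only [Ring.lie_def, Matrix.sub_apply, smul_mul_assoc, mul_smul_comm, Matrix.smul_apply,
      diagonal_mul, mul_diagonal, Matrix.add_apply, single_apply, smul_eq_mul, Complex.real_smul,
      smul_smul, Complex.I_mul_I]
    push_cast
    by_cases h1 : i = a ∧ j = b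
    · obtain ⟨rfl, rfl⟩ := h1
      simp [hij, hij.symm]
      field_simp
      ring
    · by_cases h2 : j = a ∧ i = b
      · obtain ⟨rfl, rfl⟩ := h2
        simp [hij, hij.symm]
        field_simp
        ring
      · simp [h1, h2]

/-- A skew-Hermitian traceless matrix is a combination of the matrices `z E_ij - z̄ E_ji` with
`i ≠ j` and `i t (E_kk - E_oo)`, `o` a fixed site. The latter come from brackets of `E_ko - E_ok` with
`i (E_ko + E_ok)`. -/
lemma specialUnitary_le {K : LieSubalgebra ℝ (Matrix (Fin n) (Fin n) ℂ)} {d : Fin n → ℝ}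
    (hS : ∀ i j : Fin n, i ≠ j → Complex.I • (single i j 1 + single j i 1) ∈ K)
    (hD : Complex.I • diagonal (fun k => (d k : ℂ)) ∈ K) (hd : ∃ k l, d k ≠ d l) :
    specialUnitaryLieAlgebra n ≤ K := by
  obtain ⟨o, -, -⟩ := id hd
  have hA : ∀ i j : Fin n, i ≠ j → (single i j 1 - single j i 1 : Matrix (Fin n) (Fin n) ℂ) ∈ K :=
    fun i j hij => antisymm_mem hS hD hd hij
  have hT : ∀ (i j : Fin n) (z : ℂ), i ≠ j →
      (single i j z - single j i (star z) : Matrix (Fin n) (Fin n) ℂ) ∈ K := by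
    intro i j z hij
    convert K.add_mem (K.smul_mem z.re (hA i j hij)) (K.smul_mem z.im (hS i j hij)) using 1
    ext a b
    simp only [Matrix.sub_apply, Matrix.add_apply, Matrix.smul_apply, single_apply, smul_eq_mul,
      Complex.real_smul]
    by_cases h1 : i = a ∧ j = b
    · obtain ⟨rfl, rfl⟩ := h1
      apply Complex.ext <;> simp [hij, hij.symm]
    · by_cases h2 : j = a ∧ i = b
      · obtain ⟨rfl, rfl⟩ := h2
        apply Complex.ext <;> simp [hij, hij.symm]
      · simp [h1, h2]
  -- `[A_ko, S_ko] = 2 i (E_kk - E_oo)`.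
  have hE : ∀ (k : Fin n) (t : ℝ),
      (single k k (t * Complex.I) - single o o (t * Complex.I) : Matrix (Fin n) (Fin n) ℂ) ∈ K := by
    intro k t
    by_cases hk : k = o
    · subst hk; simp
    convert K.smul_mem (t / 2) (K.lie_mem (hA k o hk) (hS k o hk)) using 1
    ext a b
    simp only [Ring.lie_def, mul_add, add_mul, mul_sub, sub_mul, mul_smul_comm, smul_mul_assoc,
      single_mul_single_same, single_mul_single_of_ne _ _ _ _ hk,
      single_mul_single_of_ne _ _ _ _ (Ne.symm hk), mul_one, Matrix.sub_apply, Matrix.add_apply,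
      Matrix.smul_apply, single_apply, smul_eq_mul, Complex.real_smul, Matrix.zero_apply]
    push_cast
    split_ifs <;> ring
  rintro X ⟨hX, htr⟩
  have hXc : ∀ i j, star (X j i) = -X i j := fun i j => congrFun (congrFun hX i) j
  have him : ∀ k, X k k = ((X k k).im : ℂ) * Complex.I := fun k => by
    have := congrArg Complex.re (hXc k k)
    simp only [Complex.star_def, Complex.conj_re, Complex.neg_re] at this
    apply Complex.ext
    · simp; linarith
    · simp
  -- Subtracting `X k k` at the reference site `o` costs nothing, as the trace vanishes; each pair
  -- of sites occurs twice in the double sum, whence the factor `1 / 2`.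
  have hsum : X = ∑ k, (single k k (X k k) - single o o (X k k))
      + (1 / 2 : ℝ) • ∑ i, ∑ j, if i = j then 0 else
          (single i j (X i j) - single j i (star (X i j))) := by
    have e1 : ∑ k, (single o o (X k k) : Matrix (Fin n) (Fin n) ℂ) = 0 := by
      have := map_sum (singleAddMonoidHom (α := ℂ) o o) (fun k => X k k) Finset.univ
      rw [show ∑ k, X k k = X.trace from rfl, htr, map_zero] at this
      exact this.symm
    rw [Finset.sum_sub_distrib, e1, sub_zero]
    ext a b
    simp only [Matrix.add_apply, Matrix.smul_apply, Matrix.sum_apply,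
      apply_ite (fun M : Matrix (Fin n) (Fin n) ℂ => M a b), Matrix.sub_apply, single_apply, Matrix.zero_apply]
    by_cases hab : a = b
    · subst hab
      rw [Finset.sum_eq_single a (by simp +contextual) (by simp)]
      simp only [and_self, if_true]
      rw [Finset.sum_eq_zero, smul_zero, add_zero]
      intro i _
      refine Finset.sum_eq_zero fun j _ => ?_
      grind
    · have e2 : ∀ i j : Fin n, (if i = j then (0 : ℂ) else
          (if i = a ∧ j = b then X i j else 0) - if j = a ∧ i = b then star (X i j) else 0)
          = (if i = a then if j = b then X a b else 0 else 0)
            + (if i = b then if j = a then X a b else 0 else 0) := by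
        intro i j
        have := hXc a b
        grind
      simp only [e2, Finset.sum_add_distrib, Finset.sum_ite_irrel, Finset.sum_const_zero,
        Finset.sum_ite_eq', Finset.mem_univ, if_true]
      rw [Finset.sum_eq_zero (by grind), zero_add, Complex.real_smul]
      push_cast
      ring
  rw [hsum]
  refine K.add_mem (sum_mem fun k _ => ?_) (K.smul_mem _ (sum_mem fun i _ => sum_mem fun j _ => ?_))
  · rw [him k]; exact hE k _
  · split_ifs with h
    · exact K.zero_mem
    · exact hT i j _ h

end Generation

/-! ### Surjectivity of the exponential map of `SU(n)` -/

section Exponential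

open Matrix

variable {m : Type*} [Fintype m] [DecidableEq m]

/-- The argument function is continuous on the finite spectrum of a unitary matrix, so the continuous
functional calculus applies to it, whatever the position of the branch cut. -/
lemma exists_isHermitian_exp_eq {V : Matrix m m ℂ} (hV : V ∈ unitary (Matrix m m ℂ)) :
    ∃ B : Matrix m m ℂ, B.IsHermitian ∧ NormedSpace.exp (Complex.I • B) = V := by
  have hn : IsStarNormal V := ⟨by
    rw [commute_iff_eq, Unitary.star_mul_self_of_mem hV, Unitary.mul_star_self_of_mem hV]⟩
  have hfin := V.finite_spectrum
  have hB : IsSelfAdjoint (cfc (Complex.ofReal ∘ Complex.arg : ℂ → ℂ) V) := .cfc_arg V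
  refine ⟨cfc (Complex.ofReal ∘ Complex.arg : ℂ → ℂ) V, hB, ?_⟩
  have hc : ContinuousOn (Complex.ofReal ∘ Complex.arg : ℂ → ℂ) (spectrum ℂ V) := hfin.continuousOn _
  rw [← CFC.exp_eq_normedSpace_exp (𝕜 := ℂ) (hB.isStarNormal.smul _),
    ← cfc_comp_smul Complex.I NormedSpace.exp _
      (by exact NormedSpace.exp_continuous.continuousOn) hB.isStarNormal,
    ← cfc_comp' (fun x => NormedSpace.exp (Complex.I • x)) (Complex.ofReal ∘ Complex.arg) V
      (by exact (NormedSpace.exp_continuous.comp (continuous_const_smul _)).continuousOn) hc]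
  conv_rhs => rw [← cfc_id' ℂ V]
  refine cfc_congr fun z hz => ?_
  have hz1 : ‖z‖ = 1 := spectrum.norm_eq_one_of_unitary hV hz
  have := Complex.norm_mul_exp_arg_mul_I z
  rw [hz1] at this
  simpa [← Complex.exp_eq_exp_ℂ, mul_comm] using this

/-- Write `V = exp (i B)` with `B = U diag(λ) U*` Hermitian. As `det V = 1`, the sum of the
eigenvalues is `2 π k` for an integer `k`; subtracting `2 π k` from a single eigenvalue makes the
trace vanish and does not change the exponential. -/
lemma exists_traceless_exp_eq {V : Matrix m m ℂ} (hV : V ∈ specialUnitaryGroup m ℂ) :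
    ∃ X : Matrix m m ℂ, Xᴴ = -X ∧ X.trace = 0 ∧ NormedSpace.exp X = V := by
  cases isEmpty_or_nonempty m with
  | inl _ => exact ⟨0, Subsingleton.elim _ _, by simp, Subsingleton.elim _ _⟩
  | inr hne =>
  obtain ⟨hVu, hdet⟩ := mem_specialUnitaryGroup_iff.1 hV
  obtain ⟨B, hB, hexp⟩ := exists_isHermitian_exp_eq hVu
  obtain ⟨o⟩ := hne
  set U : Matrix m m ℂ := (hB.eigenvectorUnitary : Matrix m m ℂ) with hU
  have hU1 : star U * U = 1 := Unitary.coe_star_mul_self _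
  have hU2 : U * star U = 1 := Unitary.coe_mul_star_self _
  have hspec : B = U * diagonal (fun k => (hB.eigenvalues k : ℂ)) * star U := by
    conv_lhs => rw [hB.spectral_theorem]
    rfl
  have hconj : ∀ f : m → ℂ, NormedSpace.exp (U * diagonal f * star U)
      = U * diagonal (NormedSpace.exp f) * star U := fun f => by
    rw [← Matrix.exp_diagonal]
    exact Matrix.exp_units_conj (⟨U, star U, hU2, hU1⟩ : (Matrix m m ℂ)ˣ) (diagonal f)
  have hexp' : V = U * diagonal (fun k => Complex.exp (Complex.I * hB.eigenvalues k)) * star U := by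
    rw [← hexp]
    conv_lhs => rw [hspec]
    rw [← smul_mul_assoc, ← mul_smul_comm, ← diagonal_smul, hconj]
    congr 3
    ext k
    simp [Pi.coe_exp, Complex.exp_eq_exp_ℂ]
  have hsum : Complex.exp (Complex.I * ∑ k, (hB.eigenvalues k : ℂ)) = 1 := by
    rw [hexp', det_mul, det_mul, det_diagonal, mul_right_comm, ← det_mul, hU2, det_one, one_mul,
      ← Complex.exp_sum, ← Finset.mul_sum] at hdet
    exact hdet
  obtain ⟨k, hk⟩ := Complex.exp_eq_one_iff.1 hsum
  have hk' : ∑ l, (hB.eigenvalues l : ℂ) = k * (2 * Real.pi) := by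
    apply mul_left_cancel₀ Complex.I_ne_zero
    rw [hk]; ring
  set e : m → ℝ := fun l => hB.eigenvalues l - if l = o then k * (2 * Real.pi) else 0 with he
  refine ⟨U * diagonal (fun l => Complex.I * e l) * star U, ?_, ?_, ?_⟩
  · rw [← star_eq_conjTranspose, star_mul, star_mul, star_star, star_eq_conjTranspose (diagonal _),
      diagonal_conjTranspose, ← mul_assoc, ← neg_mul, ← mul_neg, diagonal_neg]
    congr 3
    ext l
    simp
  · rw [trace_mul_cycle, hU1, one_mul, trace_diagonal, ← Finset.mul_sum, he]
    push_cast
    rw [Finset.sum_sub_distrib, hk']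
    simp [apply_ite]
  · rw [hconj, hexp']
    congr 3
    ext l
    rw [Pi.coe_exp, ← Complex.exp_eq_exp_ℂ]
    by_cases hl : l = o
    · simp only [he, hl, if_true]
      rw [show Complex.I * ((hB.eigenvalues o - k * (2 * Real.pi) : ℝ) : ℂ)
        = Complex.I * hB.eigenvalues o - k * (2 * Real.pi * Complex.I) by push_cast; ring,
        Complex.exp_sub, Complex.exp_int_mul_two_pi_mul_I, div_one]
    · simp [he, hl]

end Exponential

/-! ### Restriction of circuits to the one-excitation sector -/

section Restriction

open Matrix

variable {n : ℕ}

lemma encoding_conjTranspose_mul_encoding (n : ℕ) : (encoding n)ᴴ * encoding n = 1 := by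
  ext k l
  have h := restrictSector_apply (1 : BlockOperator n) k l
  rw [restrictSector, Matrix.mul_one] at h
  rw [h, one_apply, one_apply]
  simp [oneHot_injective.eq_iff]

/-- If `H` leaves the range of an intertwiner `E` invariant, acting there as `R`, then `exp H` acts
there as `exp R`. -/
lemma exp_mul_eq_mul_exp {l m : Type*} [Fintype l] [DecidableEq l] [Fintype m] [DecidableEq m]
    {H : Matrix l l ℂ} {R : Matrix m m ℂ} {E : Matrix l m ℂ} (h : H * E = E * R) :
    NormedSpace.exp H * E = E * NormedSpace.exp R := by
  have hpow : ∀ k : ℕ, H ^ k * E = E * R ^ k := fun k => by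
    induction k with
    | zero => simp
    | succ k ih => rw [pow_succ, Matrix.mul_assoc, h, ← Matrix.mul_assoc, ih, Matrix.mul_assoc,
        ← pow_succ]
  have h1 := (NormedSpace.exp_series_hasSum_exp' (𝕂 := ℂ) H).map
    (⟨⟨fun X => X * E, by simp⟩, fun X Y => Matrix.add_mul X Y E⟩ : Matrix l l ℂ →+ Matrix l m ℂ)
    (continuous_id.matrix_mul continuous_const)
  have h2 := (NormedSpace.exp_series_hasSum_exp' (𝕂 := ℂ) R).map
    (⟨⟨fun X => E * X, by simp⟩, fun X Y => Matrix.mul_add E X Y⟩ : Matrix m m ℂ →+ Matrix l m ℂ)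
    (continuous_const.matrix_mul continuous_id)
  refine h1.unique (h2.congr_fun fun k => ?_)
  simp [hpow]

lemma restrictSector_eq_of_intertwines {H : BlockOperator n} {R : Matrix (Fin n) (Fin n) ℂ}
    (h : H * encoding n = encoding n * R) : restrictSector H = R := by
  rw [restrictSector, Matrix.mul_assoc, h, ← Matrix.mul_assoc,
    encoding_conjTranspose_mul_encoding, Matrix.one_mul]

lemma restrictSector_circuit {HZ : BlockOperator n} (hZ : HZ.IsDiag)
    (l : List (ℝ × BlockOperator n)) (hl : ∀ p ∈ l, p.2 ∈ controlSet HZ) :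
    restrictSector (l.map fun p => NormedSpace.exp ((-(Complex.I * (p.1 : ℂ))) • p.2)).prod
      = (l.map fun p =>
          NormedSpace.exp ((-(Complex.I * (p.1 : ℂ))) • restrictSector p.2)).prod := by
  apply restrictSector_eq_of_intertwines
  induction l with
  | nil => simp
  | cons p l ih =>
    have hp : ((-(Complex.I * (p.1 : ℂ))) • p.2) * encoding n
        = encoding n * ((-(Complex.I * (p.1 : ℂ))) • restrictSector p.2) := by
      rw [Matrix.smul_mul, controlSet_preserves_sector hZ (hl p (by simp)), Matrix.mul_smul]
    rw [List.map_cons, List.prod_cons, List.map_cons, List.prod_cons, Matrix.mul_assoc,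
      ih fun q hq => hl q (by simp [hq]), ← Matrix.mul_assoc, exp_mul_eq_mul_exp hp,
      Matrix.mul_assoc]

end Restriction

/-! ### The dynamical Lie algebra -/

section Dynamical

open Matrix

variable {n : ℕ} {HZ : BlockOperator n}

lemma restrictSector_eq_diagonal (hHerm : HZ.IsHermitian) (hDiag : HZ.IsDiag) :
    restrictSector HZ = diagonal fun k => (((HZ (oneHot k) (oneHot k)).re : ℝ) : ℂ) := by
  ext k l
  rw [restrictSector_apply, diagonal_apply]
  split_ifs with h
  · subst h
    exact (Complex.conj_eq_iff_re.1 (hHerm.apply _ _)).symm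
  · exact hDiag fun e => h (oneHot_injective e)

lemma hopping_mem_dynamicalLieAlgebra {i j : Fin n} (hij : i ≠ j) :
    Complex.I • (single i j 1 + single j i 1) ∈ dynamicalLieAlgebra (controlSet HZ) := by
  have key : ∀ i j : Fin n, i < j →
      Complex.I • (single i j 1 + single j i 1) ∈ dynamicalLieAlgebra (controlSet HZ) := by
    intro i j hij
    have h : Complex.I • restrictSector (hopping i j) ∈ dynamicalLieAlgebra (controlSet HZ) :=
      LieSubalgebra.subset_lieSpan ⟨_, Or.inl ⟨i, j, hij, rfl⟩, rfl⟩
    rw [restrictSector_hopping hij] at h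
    convert LieSubalgebra.smul_mem _ (1 / 2 : ℝ) h using 1
    ext a b
    simp only [Matrix.smul_apply, smul_eq_mul, Complex.real_smul]
    push_cast
    ring
  rcases hij.lt_or_gt with h | h
  · exact key i j h
  · rw [add_comm]; exact key j i h

lemma specialUnitary_le_dynamicalLieAlgebra (hHerm : HZ.IsHermitian) (hDiag : HZ.IsDiag)
    (hNontrivial : ¬ ∃ c : ℂ, restrictSector HZ = c • (1 : Matrix (Fin n) (Fin n) ℂ)) :
    specialUnitaryLieAlgebra n ≤ dynamicalLieAlgebra (controlSet HZ) := by
  refine specialUnitary_le (d := fun k => (HZ (oneHot k) (oneHot k)).re)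
    (fun i j hij => hopping_mem_dynamicalLieAlgebra hij) ?_ ?_
  · rw [← restrictSector_eq_diagonal hHerm hDiag]
    exact LieSubalgebra.subset_lieSpan ⟨HZ, Or.inr rfl, rfl⟩
  · by_contra! hc
    refine hNontrivial ?_
    rw [restrictSector_eq_diagonal hHerm hDiag]
    rcases isEmpty_or_nonempty (Fin n) with _ | ⟨⟨o⟩⟩
    · exact ⟨0, Subsingleton.elim _ _⟩
    · exact ⟨((HZ (oneHot o) (oneHot o)).re : ℝ), by
        rw [smul_one_eq_diagonal]
        congr 1
        ext k
        rw [hc k o]⟩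

lemma isHermitian_restrictSector (hHerm : HZ.IsHermitian) {H : BlockOperator n}
    (hH : H ∈ controlSet HZ) : (restrictSector H).IsHermitian := by
  rcases hH with ⟨i, j, hij, rfl⟩ | rfl
  · rw [restrictSector_hopping hij, IsHermitian, conjTranspose_smul, conjTranspose_add,
      conjTranspose_single, conjTranspose_single, star_one, add_comm]
    simp
  · ext k l
    rw [conjTranspose_apply, restrictSector_apply, restrictSector_apply]
    exact hHerm.apply _ _

lemma generator_mem_unitaryLieAlgebra (hHerm : HZ.IsHermitian) {H : BlockOperator n}
    (hH : H ∈ controlSet HZ) : Complex.I • restrictSector H ∈ unitaryLieAlgebra n := by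
  change (Complex.I • restrictSector H)ᴴ = -(Complex.I • restrictSector H)
  rw [conjTranspose_smul, isHermitian_restrictSector hHerm hH]
  simp

lemma dynamicalLieAlgebra_le_unitary (hHerm : HZ.IsHermitian) :
    dynamicalLieAlgebra (controlSet HZ) ≤ unitaryLieAlgebra n := by
  refine LieSubalgebra.lieSpan_le.2 ?_
  rintro _ ⟨H, hH, rfl⟩
  exact generator_mem_unitaryLieAlgebra hHerm hH

lemma dynamicalLieAlgebra_le_specialUnitary (hHerm : HZ.IsHermitian)
    (htr : (restrictSector HZ).trace = 0) :
    dynamicalLieAlgebra (controlSet HZ) ≤ specialUnitaryLieAlgebra n := by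
  refine LieSubalgebra.lieSpan_le.2 ?_
  rintro _ ⟨H, hH, rfl⟩
  refine ⟨generator_mem_unitaryLieAlgebra hHerm hH, ?_⟩
  dsimp only
  rw [trace_smul]
  rcases hH with ⟨i, j, hij, rfl⟩ | rfl
  · rw [restrictSector_hopping hij]
    simp [trace_single_eq_of_ne, hij.ne, hij.ne']
  · rw [htr, smul_zero]

lemma trace_eq_im_mul_I {X : Matrix (Fin n) (Fin n) ℂ} (hX : X ∈ unitaryLieAlgebra n) :
    X.trace = (X.trace.im : ℂ) * Complex.I := by
  change Xᴴ = -X at hX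
  have h := congrArg (fun M => (trace M).re) hX
  simp only [trace_conjTranspose, trace_neg, Complex.star_def, Complex.conj_re, Complex.neg_re] at h
  apply Complex.ext
  · simp; linarith
  · simp

lemma tracelessPart_mem_specialUnitary (hn : n ≠ 0) {X : Matrix (Fin n) (Fin n) ℂ}
    (hX : X ∈ unitaryLieAlgebra n) : tracelessPart X ∈ specialUnitaryLieAlgebra n := by
  have hn' : (n : ℂ) ≠ 0 := Nat.cast_ne_zero.2 hn
  refine ⟨?_, ?_⟩
  · have hX' : Xᴴ = -X := hX
    have hs : star (X.trace / (n : ℂ)) = -(X.trace / (n : ℂ)) := by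
      rw [trace_eq_im_mul_I hX]
      simp [neg_div]
    rw [tracelessPart, conjTranspose_sub, conjTranspose_smul, hX', hs, conjTranspose_one, neg_smul]
    abel
  · rw [tracelessPart, trace_sub, trace_smul, trace_one, Fintype.card_fin, smul_eq_mul,
      div_mul_cancel₀ _ hn', sub_self]

lemma tracelessPart_of_trace_eq_zero {X : Matrix (Fin n) (Fin n) ℂ} (h : X.trace = 0) :
    tracelessPart X = X := by
  rw [tracelessPart, h, zero_div, zero_smul, sub_zero]

/-- `𝔰𝔲(n)` has real codimension one in `𝔲(n)`: subtracting from an element of `𝔲(n)` a real multiple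
of a fixed `D ∈ 𝔲(n)` with nonzero (hence nonzero imaginary) trace makes it traceless. -/
lemma unitary_le_of_specialUnitary_le
    {K : LieSubalgebra ℝ (Matrix (Fin n) (Fin n) ℂ)} (hK : specialUnitaryLieAlgebra n ≤ K)
    {D : Matrix (Fin n) (Fin n) ℂ} (hD : D ∈ unitaryLieAlgebra n) (hDK : D ∈ K)
    (htr : D.trace ≠ 0) : unitaryLieAlgebra n ≤ K := by
  intro X hX
  set c : ℝ := X.trace.im / D.trace.im with hc
  have hDim : D.trace.im ≠ 0 := fun h => htr (by rw [trace_eq_im_mul_I hD, h]; simp)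
  have h : X - c • D ∈ specialUnitaryLieAlgebra n := by
    refine ⟨(unitaryLieAlgebra n).sub_mem hX ((unitaryLieAlgebra n).smul_mem c hD), ?_⟩
    have hDim' : (D.trace.im : ℂ) ≠ 0 := by exact_mod_cast hDim
    rw [trace_sub, trace_smul, trace_eq_im_mul_I hX, Complex.real_smul]
    rw [trace_eq_im_mul_I hD, hc]
    push_cast
    field_simp
    simp
  have := K.add_mem (hK h) (K.smul_mem c hDK)
  rwa [sub_add_cancel] at this

end Dynamical

/-! ### Approximate universality -/

section Universality

open Matrix

variable {n : ℕ} {HZ : BlockOperator n}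

/-- Every element of `exp 𝔰𝔲(n) = SU(n)` lies in the closure of the submonoid of restricted circuits,
since the Lie algebra of this closure contains the generators `i H`. -/
lemma mem_closure_of_mem_specialUnitaryGroup [NeZero n] (hHerm : HZ.IsHermitian)
    (hDiag : HZ.IsDiag)
    (hNontrivial : ¬ ∃ c : ℂ, restrictSector HZ = c • (1 : Matrix (Fin n) (Fin n) ℂ))
    {V : Matrix (Fin n) (Fin n) ℂ} (hV : V ∈ specialUnitaryGroup (Fin n) ℂ) :
    V ∈ closure (Submonoid.closure {U | ∃ (θ : ℝ), ∃ H ∈ controlSet HZ,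
      U = NormedSpace.exp ((-(Complex.I * (θ : ℂ))) • restrictSector H)} :
        Set (Matrix (Fin n) (Fin n) ℂ)) := by
  set S : Submonoid (Matrix (Fin n) (Fin n) ℂ) := Submonoid.closure {U | ∃ (θ : ℝ),
    ∃ H ∈ controlSet HZ, U = NormedSpace.exp ((-(Complex.I * (θ : ℂ))) • restrictSector H)}
  have hM : IsClosed (S.topologicalClosure : Set (Matrix (Fin n) (Fin n) ℂ)) :=
    S.isClosed_topologicalClosure
  have hle : dynamicalLieAlgebra (controlSet HZ) ≤
      closedSubmonoidLieAlgebra S.topologicalClosure hM := by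
    refine LieSubalgebra.lieSpan_le.2 ?_
    rintro _ ⟨H, hH, rfl⟩
    refine mem_closedSubmonoidLieAlgebra.2 fun t => S.le_topologicalClosure ?_
    -- `exp (t (i H))` is the gate `exp (-i θ H)` of angle `θ = -t`.
    refine Submonoid.subset_closure ⟨-t, H, hH, ?_⟩
    congr 1
    ext a b
    simp only [Matrix.smul_apply, smul_eq_mul, Complex.real_smul]
    push_cast
    ring
  obtain ⟨X, hX, hX0, rfl⟩ := exists_traceless_exp_eq hV
  have hXm : X ∈ specialUnitaryLieAlgebra n := ⟨hX, hX0⟩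
  have := mem_closedSubmonoidLieAlgebra.1
    (hle (specialUnitary_le_dynamicalLieAlgebra hHerm hDiag hNontrivial hXm)) 1
  rw [one_smul] at this
  exact this

/-- An element of the submonoid generated by the restricted exponentials is the restriction of a
circuit on the whole block. -/
lemma exists_circuit_of_mem_closure (hDiag : HZ.IsDiag) {W : Matrix (Fin n) (Fin n) ℂ}
    (hW : W ∈ Submonoid.closure {U | ∃ (θ : ℝ), ∃ H ∈ controlSet HZ,
      U = NormedSpace.exp ((-(Complex.I * (θ : ℂ))) • restrictSector H)}) :
    ∃ (L : ℕ) (θ : Fin L → ℝ) (H : Fin L → BlockOperator n), (∀ l, H l ∈ controlSet HZ) ∧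
      restrictSector (List.ofFn fun l =>
        NormedSpace.exp ((-(Complex.I * (θ l : ℂ))) • H l)).prod = W := by
  obtain ⟨l, hl, rfl⟩ : ∃ l : List (ℝ × BlockOperator n), (∀ p ∈ l, p.2 ∈ controlSet HZ) ∧
      (l.map fun p => NormedSpace.exp ((-(Complex.I * (p.1 : ℂ))) • restrictSector p.2)).prod
        = W := by
    induction hW using Submonoid.closure_induction with
    | mem _ h =>
      obtain ⟨θ, H, hH, rfl⟩ := h
      exact ⟨[(θ, H)], by simpa using hH, by simp⟩
    | one => exact ⟨[], by simp, by simp⟩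
    | mul _ _ _ _ h1 h2 =>
      obtain ⟨l₁, hl₁, rfl⟩ := h1
      obtain ⟨l₂, hl₂, rfl⟩ := h2
      exact ⟨l₁ ++ l₂, fun p hp => (List.mem_append.1 hp).elim (hl₁ p) (hl₂ p), by simp⟩
  refine ⟨l.length, fun k => l[k].1, fun k => l[k].2, fun k => hl _ (List.getElem_mem _), ?_⟩
  rw [← restrictSector_circuit hDiag l hl]
  congr 2
  exact List.ofFn_getElem_eq_map l
    fun p => NormedSpace.exp ((-(Complex.I * (p.1 : ℂ))) • p.2)

end Universality

end OneHotBlock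

theorem mainTheorem9 (n : ℕ) (HZ : OneHotBlock.BlockOperator n)
    (hHerm : HZ.IsHermitian) (hDiag : HZ.IsDiag)
    (hNontrivial : ¬ ∃ c : ℂ,
      OneHotBlock.restrictSector HZ = c • (1 : Matrix (Fin n) (Fin n) ℂ)) :
    -- the dynamical Lie algebra is `𝔰𝔲(n)` modulo global phases
    (OneHotBlock.tracelessPart ''
        (OneHotBlock.dynamicalLieAlgebra (OneHotBlock.controlSet HZ) :
          Set (Matrix (Fin n) (Fin n) ℂ))
      = (OneHotBlock.specialUnitaryLieAlgebra n : Set (Matrix (Fin n) (Fin n) ℂ))) ∧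
    -- it is `𝔰𝔲(n)` itself when the restricted diagonal term is traceless
    ((OneHotBlock.restrictSector HZ).trace = 0 →
      OneHotBlock.dynamicalLieAlgebra (OneHotBlock.controlSet HZ)
        = OneHotBlock.specialUnitaryLieAlgebra n) ∧
    -- and it is `𝔲(n)`, that is `𝔰𝔲(n)` together with the global phases, otherwise
    ((OneHotBlock.restrictSector HZ).trace ≠ 0 →
      OneHotBlock.dynamicalLieAlgebra (OneHotBlock.controlSet HZ)
        = OneHotBlock.unitaryLieAlgebra n) ∧
    -- approximate universality, in operator norm
    (∀ V ∈ Matrix.specialUnitaryGroup (Fin n) ℂ, ∀ ε : ℝ, 0 < ε →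
      ∃ (L : ℕ) (θ : Fin L → ℝ) (H : Fin L → OneHotBlock.BlockOperator n),
        (∀ l, H l ∈ OneHotBlock.controlSet HZ) ∧
        ‖V - OneHotBlock.restrictSector
          (List.ofFn fun l => NormedSpace.exp ((-(Complex.I * (θ l : ℂ))) • H l)).prod‖ ≤ ε) := by
  -- The `0 × 0` matrix is scalar, so the sector is not zero.
  have hn : n ≠ 0 := by
    rintro rfl
    exact hNontrivial ⟨0, Subsingleton.elim _ _⟩
  have : NeZero n := ⟨hn⟩
  have hsu := OneHotBlock.specialUnitary_le_dynamicalLieAlgebra hHerm hDiag hNontrivial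
  have hu := OneHotBlock.dynamicalLieAlgebra_le_unitary hHerm
  refine ⟨Set.Subset.antisymm ?_ ?_, fun htr => ?_, fun htr => ?_, fun V hV ε hε => ?_⟩
  · rintro _ ⟨X, hX, rfl⟩
    exact OneHotBlock.tracelessPart_mem_specialUnitary hn (hu hX)
  · intro X hX
    exact ⟨X, hsu hX, OneHotBlock.tracelessPart_of_trace_eq_zero hX.2⟩
  · exact le_antisymm (OneHotBlock.dynamicalLieAlgebra_le_specialUnitary hHerm htr) hsu
  · have hZ : HZ ∈ OneHotBlock.controlSet HZ := Or.inr rfl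
    refine le_antisymm hu (OneHotBlock.unitary_le_of_specialUnitary_le hsu
      (OneHotBlock.generator_mem_unitaryLieAlgebra hHerm hZ)
      (LieSubalgebra.subset_lieSpan ⟨HZ, hZ, rfl⟩) ?_)
    rw [Matrix.trace_smul]
    exact smul_ne_zero Complex.I_ne_zero htr
  · obtain ⟨W, hW, hVW⟩ := Metric.mem_closure_iff.1
      (OneHotBlock.mem_closure_of_mem_specialUnitaryGroup hHerm hDiag hNontrivial hV) ε hε
    obtain ⟨L, θ, H, hH, rfl⟩ := OneHotBlock.exists_circuit_of_mem_closure hDiag hW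
    exact ⟨L, θ, H, hH, by rw [← dist_eq_norm]; exact hVW.le⟩
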